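/- Let $\mathbb K\in\{\mathbb R,\mathbb C\}$, let $\mathcal H$ be a finite-dimensional one-particle Hilbert space over $\mathbb K$ with orthonormal basis $(e_\alpha)$, and let $a^\dagger_\alpha,a_\alpha$ be the creation and annihilation operators on its fermionic Fock space. Let $N\ge 2$ and let $\Gamma$ be an integer-$N$-representable two-particle density matrix, i.e. there are normalized $N$-fermion states $\Psi_i$ and weights $w_i\ge 0$, $\sum_i w_i=1$ (finitely many), with $$\Gamma_{\alpha\beta;\gamma\delta}=\sum_i w_i\langle\Psi_i|a^\dagger_\alpha a^\dagger_\beta a_\delta a_\gamma|\Psi_i\rangle .$$ Matrix elements of $\Gamma$ in arbitrary orbitals are obtained by extending these linearly in the first two and antilinearly in the last two indices. Let $\mathcal V\subseteq\mathcal H$ be any linear subspace with orthonormal basis indexed by $a,b,c,d,\dots$, and put $$\Gamma^{\mathcal V}_{ab;cd}=\Gamma_{ab;cd},\qquad \rho^{\mathcal V}_{ac}=\frac1{N-1}\sum_\beta\Gamma_{a\beta;c\beta},$$ where $\beta$ runs over the orthonormal basis of $\mathcal H$. Then $\bar N=\operatorname{Tr}\rho^{\mathcal V}=\sum_a\rho^{\mathcal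 V}_{aa}$ is real and the pair $(\rho^{\mathcal V},\Gamma^{\mathcal V})$ is fractional-$\bar N$-representable on $\mathcal V$: there are finitely many weights $x_k\ge 0$ and normalized states $\Phi_k$ in the fermionic Fock space of $\mathcal V$, where $\Phi_k$ has exactly $n_k$ particles, with $\sum_k x_k=1$, $\sum_k x_kn_k=\bar N$, and $$\rho^{\mathcal V}_{ac}=\sum_k x_k\langle\Phi_k|a^\dagger_a a_c|\Phi_k\rangle,\qquad \Gamma^{\mathcal V}_{ab;cd}=\sum_k x_k\langle\Phi_k|a^\dagger_a a^\dagger_b a_d a_c|\Phi_k\rangle .$$ Consequently, for every Hamiltonian $\hat H^{\mathcal V}=\sum_{ab}t_{ab}a^\dagger_a a_b+\frac14\sum_{abcd}V_{ab;cd}a^\dagger_a a^\dagger_b a_d a_c$ on the Fock space of $\mathcal V$ with $t_{ba}=\overline{t_{ab}}$ and $V_{cd;ab}=\overline{V_{ab;cd}}$, the number $\operatorname{Tr}\rho^{\mathcal V}t+\operatorname{Tr}\Gamma^{\mathcal V}V:=\sum_{ab}\rho^{\mathcal V}_{ab}t_{ab}+\frac14\sum_{abcd}\Gamma^{\mathcal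 V}_{ab;cd}V_{ab;cd}$ is real and $$\operatorname{Tr}\rho^{\mathcal V}t+\operatorname{Tr}\Gamma^{\mathcal V}V\ \ge\ E_0^{\bar N}(\hat H^{\mathcal V}),$$ where $E_0^{\bar N}(\hat H)$ is the infimum of $\sum_k x_k\langle\Phi_k|\hat H|\Phi_k\rangle$ over all ensembles $(x_k,n_k,\Phi_k)$ as above with average particle number $\sum_k x_kn_k=\bar N$. -/

import Mathlib

namespace SubsystemConstraints

open scoped BigOperators

noncomputable section

/-- Fermionic Fock space over a finite, linearly ordered set `ι` of orthonormal orbitals: the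
Hilbert space with orthonormal basis the Slater determinants `|s⟩`, `s ⊆ ι`. -/
abbrev Fock (𝕜 ι : Type*) := EuclideanSpace 𝕜 (Finset ι)

section Operators

variable {𝕜 ι : Type*} [RCLike 𝕜] [Fintype ι] [LinearOrder ι]

/-- The annihilation operator `a_i`: it sends `|insert i s⟩` (with `i ∉ s`) to
`(-1)^{#{j ∈ s | j < i}} |s⟩`, and `|s⟩` with `i ∉ s` to `0`. -/
def annihilate (i : ι) : Fock 𝕜 ι →ₗ[𝕜] Fock 𝕜 ι where
  toFun Ψ := WithLp.toLp 2 fun s =>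
    if i ∈ s then 0 else (-1 : 𝕜) ^ (s.filter (· < i)).card * Ψ (insert i s)
  map_add' Ψ Φ := by
    ext s
    by_cases h : i ∈ s <;> simp [h, mul_add]
  map_smul' c Ψ := by
    ext s
    by_cases h : i ∈ s <;> simp [h, mul_left_comm]

/-- The creation operator `a†_i`, the Hilbert space adjoint of `a_i`. -/
def create (i : ι) : Fock 𝕜 ι →ₗ[𝕜] Fock 𝕜 ι :=
  LinearMap.adjoint (annihilate (𝕜 := 𝕜) i)

/-- `⟨Ψ| A |Ψ⟩`. -/
def expect (A : Fock 𝕜 ι →ₗ[𝕜] Fock 𝕜 ι) (Ψ : Fock 𝕜 ι) : 𝕜 :=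
  inner 𝕜 Ψ (A Ψ)

/-- The one-body string `a†_α a_β`. -/
def oneBody (α β : ι) : Fock 𝕜 ι →ₗ[𝕜] Fock 𝕜 ι :=
  create α ∘ₗ annihilate β

/-- The two-body string `a†_α a†_β a_δ a_γ`, with index order `αβ;γδ`. -/
def twoBody (α β γ δ : ι) : Fock 𝕜 ι →ₗ[𝕜] Fock 𝕜 ι :=
  create α ∘ₗ create β ∘ₗ annihilate δ ∘ₗ annihilate γ

/-- `Ψ` is a normalized wave function with exactly `N` particles. -/
def IsNParticleState (N : ℕ) (Ψ : Fock 𝕜 ι) : Prop :=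
  ‖Ψ‖ = 1 ∧ ∀ s : Finset ι, Ψ s ≠ 0 → s.card = N

/-- The numbers `Γ_{αβ;γδ}` are the matrix elements of an integer-`N`-representable
two-particle density matrix (2DM). -/
def IsNRepresentable (N : ℕ) (Γ : ι → ι → ι → ι → 𝕜) : Prop :=
  ∃ (m : ℕ) (w : Fin m → ℝ) (Ψ : Fin m → Fock 𝕜 ι),
    (∀ i, 0 ≤ w i) ∧ ∑ i, w i = 1 ∧ (∀ i, IsNParticleState N (Ψ i)) ∧
    ∀ α β γ δ, Γ α β γ δ = ∑ i, (w i : 𝕜) * expect (twoBody α β γ δ) (Ψ i)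

/-- The weights `x i` and the `n i`-particle states `Ψ i` form an ensemble with average particle
number `Nbar`. -/
def IsFracEnsemble (Nbar : ℝ) {m : ℕ} (x : Fin m → ℝ) (n : Fin m → ℕ)
    (Ψ : Fin m → Fock 𝕜 ι) : Prop :=
  (∀ i, 0 ≤ x i) ∧ ∑ i, x i = 1 ∧ ∑ i, x i * (n i : ℝ) = Nbar ∧
    ∀ i, IsNParticleState (n i) (Ψ i)

/-- The pair `(ρ, Γ)` is fractional-`Nbar`-representable: both are derived from one and the same
ensemble with average particle number `Nbar`. -/
def IsFracRepresentable (Nbar : ℝ) (ρ : ι → ι → 𝕜) (Γ : ι → ι → ι → ι → 𝕜) : Prop :=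
  ∃ (m : ℕ) (x : Fin m → ℝ) (n : Fin m → ℕ) (Ψ : Fin m → Fock 𝕜 ι),
    IsFracEnsemble Nbar x n Ψ ∧
    (∀ α β, ρ α β = ∑ i, (x i : 𝕜) * expect (oneBody α β) (Ψ i)) ∧
    ∀ α β γ δ, Γ α β γ δ = ∑ i, (x i : 𝕜) * expect (twoBody α β γ δ) (Ψ i)

/-- `H = ∑ t_{αβ} a†_α a_β + (1/4) ∑ W_{αβ;γδ} a†_α a†_β a_δ a_γ`. -/
def hamiltonian (t : ι → ι → 𝕜) (W : ι → ι → ι → ι → 𝕜) : Fock 𝕜 ι →ₗ[𝕜] Fock 𝕜 ι :=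
  ∑ α, ∑ β, t α β • oneBody α β +
    (1 / 4 : 𝕜) • ∑ α, ∑ β, ∑ γ, ∑ δ, W α β γ δ • twoBody α β γ δ

/-- `E_0^{Nbar}(H)`: the infimum of the energy over all ensembles with average particle number
`Nbar`. -/
def groundEnergy (Nbar : ℝ) (H : Fock 𝕜 ι →ₗ[𝕜] Fock 𝕜 ι) : ℝ :=
  sInf {E : ℝ | ∃ (m : ℕ) (x : Fin m → ℝ) (n : Fin m → ℕ) (Ψ : Fin m → Fock 𝕜 ι),
    IsFracEnsemble Nbar x n Ψ ∧ E = ∑ i, x i * RCLike.re (expect H (Ψ i))}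

/-- `Tr ρ`. -/
def trace₁ (ρ : ι → ι → 𝕜) : 𝕜 := ∑ α, ρ α α

/-- `Tr ρ t + Tr Γ W`, with `Tr ρ t = ∑ ρ_{αβ} t_{αβ}` and
`Tr Γ W = (1/4) ∑ Γ_{αβ;γδ} W_{αβ;γδ}`. As `ρ_{αβ} = ⟨a†_α a_β⟩` and `t_{αβ}` multiplies
`a†_α a_β`, the indices are contracted in equal order. -/
def energy (ρ : ι → ι → 𝕜) (Γ : ι → ι → ι → ι → 𝕜) (t : ι → ι → 𝕜)
    (W : ι → ι → ι → ι → 𝕜) : 𝕜 :=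
  ∑ α, ∑ β, ρ α β * t α β +
    (1 / 4 : 𝕜) * ∑ α, ∑ β, ∑ γ, ∑ δ, Γ α β γ δ * W α β γ δ

end Operators

section Subspace

variable {𝕜 ι κ E : Type*} [RCLike 𝕜] [Fintype ι] [Fintype κ]
  [NormedAddCommGroup E] [InnerProductSpace 𝕜 E]

/-- The matrix element `Γ_{fg;hk}` in arbitrary orbitals `f, g, h, k`, given the matrix elements
of `Γ` in the orthonormal basis `e`: it is linear in `f, g` and antilinear in `h, k`, as
`a†_f a†_g a_k a_h` is. -/
def matrixElement (e : OrthonormalBasis ι 𝕜 E) (Γ : ι → ι → ι → ι → 𝕜) (f g h k : E) : 𝕜 :=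
  ∑ α, ∑ β, ∑ γ, ∑ δ,
    inner 𝕜 (e α) f * inner 𝕜 (e β) g * inner 𝕜 h (e γ) * inner 𝕜 k (e δ) * Γ α β γ δ

/-- `Γ^V_{ab;cd} = Γ_{ab;cd}` for the orbitals `a, b, c, d` of an orthonormal basis `v` of `V`. -/
def subsystem2DM (e : OrthonormalBasis ι 𝕜 E) (V : Submodule 𝕜 E) (v : OrthonormalBasis κ 𝕜 V)
    (Γ : ι → ι → ι → ι → 𝕜) (a b c d : κ) : 𝕜 :=
  matrixElement e Γ (v a : E) (v b : E) (v c : E) (v d : E)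

/-- `ρ^V_{ac} = (1/(N-1)) ∑_β Γ_{aβ;cβ}`, where `a, c` are orbitals of `V` and `β` runs over the
orthonormal basis `e` of the whole one-particle space. -/
def subsystem1DM (N : ℕ) (e : OrthonormalBasis ι 𝕜 E) (V : Submodule 𝕜 E)
    (v : OrthonormalBasis κ 𝕜 V) (Γ : ι → ι → ι → ι → 𝕜) (a c : κ) : 𝕜 :=
  (1 / ((N : 𝕜) - 1)) * ∑ β, matrixElement e Γ (v a : E) (e β) (v c : E) (e β)

end Subspace

end

end SubsystemConstraints

namespace SubsystemConstraints

open scoped BigOperators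

noncomputable section

/-! ### Reduction operators in an abstract algebra of anticommutation relations -/

section CAR

variable {R κ : Type*} [Ring R] [StarRing R]

/-! The proof is a partial trace over the complement of `V`, done without extending the basis of `V`
or changing basis in Fock space. Let A_a be the annihilators of the orbitals of `V`, as operators on
the full Fock space, and let P_s (`reduceOp`) empty the modes in s and project the other modes of
`V` onto their vacuum. The anticommutation relations give Σ_s P_s† P_s = 1 (`sum_reduceOp`) and show
that P_s A_a is 0 or ± P_{s ∪ {a}}, with the sign used in `annihilate` (`reduceOp_mul`).

Hence, for each determinant u of the full space, s ↦ (P_s Ψ)(u) is a vector of Fock(V)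
(`reduceState`). This map turns A_a into `annihilate a`, and summing over u preserves inner
products. Since P_s removes |s| particles, an N-particle Ψ has components with N - |u| particles.
Normalizing them and moving the squared norms into the weights gives the ensemble
(`exists_fracEnsemble`).

Its two-body matrix is Γ^V directly. Its one-body matrix is ρ^V because the number operator acts as
N - 1 on A_c Ψ, cancelling the factor 1/(N-1). The energy is linear in the pair, so it is the mean
energy of an admissible ensemble. -/

/-- The family `A` satisfies the canonical anticommutation relations. -/
structure IsCAR [DecidableEq κ] (A : κ → R) : Prop where
  anticomm : ∀ a b, A a * A b + A b * A a = 0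
  sq : ∀ a, A a * A a = 0
  mixed : ∀ a b, A a * star (A b) + star (A b) * A a = if a = b then 1 else 0

/-- The factor of the mode `a` in `reduceOp`: `A_a` if `a` is occupied in `s`, and the projection
`A_a A_a†` onto the empty mode otherwise. -/
def modeFactor [DecidableEq κ] (A : κ → R) (s : Finset κ) (a : κ) : R :=
  if a ∈ s then A a else A a * star (A a)

/-- The ordered product of the factors of the modes in `l`. -/
def modeProd [DecidableEq κ] (A : κ → R) (s : Finset κ) (l : List κ) : R :=
  (l.map (modeFactor A s)).prod

section

variable [DecidableEq κ] {A : κ → R}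

theorem modeProd_cons (s : Finset κ) (a : κ) (l : List κ) :
    modeProd A s (a :: l) = modeFactor A s a * modeProd A s l := by
  simp [modeProd]

theorem modeProd_insert_of_notMem (s : Finset κ) {a : κ} {l : List κ} (h : a ∉ l) :
    modeProd A (insert a s) l = modeProd A s l := by
  unfold modeProd
  congr 1
  refine List.map_congr_left fun b hb => ?_
  have : b ≠ a := fun h' => h (h' ▸ hb)
  simp [modeFactor, this]

namespace IsCAR

theorem mul_star_mul (hA : IsCAR A) (a : κ) : A a * star (A a) * A a = A a := by
  have h := hA.mixed a a
  rw [if_pos rfl] at h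
  rw [mul_assoc, ← add_sub_cancel_left (A a * star (A a)) (star (A a) * A a), h, mul_sub,
    mul_one, ← mul_assoc, hA.sq, zero_mul, sub_zero]

/-- The two choices for the outermost mode contribute A A† and A† A, which add up to 1, so the sum
collapses one mode at a time. -/
theorem sum_star_mul_self (hA : IsCAR A) (l : List κ) (hl : l.Nodup) :
    ∑ s ∈ l.toFinset.powerset, star (modeProd A s l) * modeProd A s l = 1 := by
  induction l with
  | nil => simp [modeProd]
  | cons a l ih =>
    obtain ⟨ha, hl⟩ := List.nodup_cons.1 hl
    rw [List.toFinset_cons, Finset.sum_powerset_insert (by simpa using ha), ← ih hl,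
      ← Finset.sum_add_distrib]
    refine Finset.sum_congr rfl fun s hs => ?_
    have has : a ∉ s := fun h => ha (by simpa using Finset.mem_powerset.1 hs h)
    rw [modeProd_cons, modeProd_cons, modeProd_insert_of_notMem s ha]
    have h1 : modeFactor A s a = A a * star (A a) := by simp [modeFactor, has]
    have h2 : modeFactor A (insert a s) a = A a := by simp [modeFactor]
    rw [h1, h2]
    have h := hA.mixed a a
    rw [if_pos rfl] at h
    have h3 : star (A a * star (A a)) * (A a * star (A a)) = A a * star (A a) := by
      rw [star_mul, star_star, ← mul_assoc, hA.mul_star_mul]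
    calc _ = star (modeProd A s l) * (star (A a * star (A a)) * (A a * star (A a))
              + star (A a) * A a) * modeProd A s l := by
            simp only [star_mul, mul_add, add_mul, mul_assoc]
      _ = _ := by rw [h3, h, mul_one]

/-- Factors of occupied modes are odd and anticommute with `A a`; factors of empty modes are
quadratic and commute with it. -/
theorem modeProd_mul_of_notMem (hA : IsCAR A) (s : Finset κ) (a : κ) (l : List κ) (h : a ∉ l) :
    modeProd A s l * A a = (-1) ^ l.countP (· ∈ s) * (A a * modeProd A s l) := by
  induction l with
  | nil => simp [modeProd]
  | cons b l ih =>
    rw [List.mem_cons, not_or] at h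
    have hab : A b * A a = -(A a * A b) := eq_neg_of_add_eq_zero_left (hA.anticomm b a)
    have hab' : star (A b) * A a = -(A a * star (A b)) := by
      have := hA.mixed a b
      rw [if_neg h.1] at this
      exact eq_neg_of_add_eq_zero_right this
    have hc : ∀ (n : ℕ) (x : R), x * (-1) ^ n = (-1) ^ n * x := fun n x =>
      ((Commute.neg_one_right x).pow_right n).eq
    rw [modeProd_cons, mul_assoc, ih h.2, ← mul_assoc, hc]
    by_cases hb : b ∈ s
    · rw [List.countP_cons_of_pos (by simpa using hb), modeFactor, if_pos hb, pow_succ]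
      rw [mul_assoc, ← mul_assoc (A b), hab]
      simp [mul_assoc]
    · rw [List.countP_cons_of_neg (by simpa using hb), modeFactor, if_neg hb]
      have : A b * star (A b) * A a = A a * (A b * star (A b)) := by
        rw [mul_assoc, hab', mul_neg, ← mul_assoc, hab, neg_mul, neg_neg, mul_assoc]
      rw [mul_assoc, ← mul_assoc (A b * _), this]
      simp [mul_assoc]

end IsCAR

end

/-- The operator `P₀ A_s`, up to order: it empties the modes occupied in `s` and projects onto the
vacuum of the modes `κ`. -/
def reduceOp [LinearOrder κ] [Fintype κ] (A : κ → R) (s : Finset κ) : R :=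
  modeProd A s (Finset.univ.sort (· ≥ ·))

namespace IsCAR

variable [LinearOrder κ] {A : κ → R}

/-- In a descending list, `A a` coming from the right crosses only modes below `a` before meeting
its own factor. There A A = 0 if `a` is occupied, and A A† A = A turns an empty mode into an
occupied one. -/
theorem modeProd_mul_of_mem (hA : IsCAR A) (s : Finset κ) (a : κ) (l : List κ)
    (hl : l.Pairwise (· > ·)) (ha : a ∈ l) :
    modeProd A s l * A a =
      if a ∈ s then 0 else
        (-1) ^ l.countP (fun j => j ∈ s ∧ j < a) * modeProd A (insert a s) l := by
  induction l with
  | nil => simp at ha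
  | cons b l ih =>
    obtain ⟨hb, hl⟩ := List.pairwise_cons.1 hl
    have hc : ∀ (n : ℕ) (x : R), x * (-1) ^ n = (-1) ^ n * x := fun n x =>
      ((Commute.neg_one_right x).pow_right n).eq
    rw [modeProd_cons, modeProd_cons, mul_assoc]
    by_cases hab : a = b
    · subst hab
      have hal : a ∉ l := fun h => lt_irrefl _ (hb a h)
      rw [hA.modeProd_mul_of_notMem s a l hal, modeProd_insert_of_notMem s hal, ← mul_assoc, hc,
        mul_assoc, ← mul_assoc (modeFactor A s a)]
      split_ifs with has
      · rw [modeFactor, if_pos has, hA.sq, zero_mul, mul_zero]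
      · rw [modeFactor, if_neg has, hA.mul_star_mul, modeFactor,
          if_pos (Finset.mem_insert_self a s), List.countP_cons_of_neg (by simp)]
        -- All modes after `a` in the list lie below `a`, so the condition `j < a` is automatic.
        congr 2
        refine List.countP_congr fun j hj => ?_
        simpa using fun _ => hb j hj
    · have hal : a ∈ l := (List.mem_cons.1 ha).resolve_left hab
      rw [ih hl hal]
      split_ifs with has
      · rw [mul_zero]
      · have : ¬ (b ∈ s ∧ b < a) := fun h => lt_asymm h.2 (hb a hal)
        rw [List.countP_cons_of_neg (by simpa using this), ← mul_assoc, hc, mul_assoc]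
        have : modeFactor A (insert a s) b = modeFactor A s b := by
          simp [modeFactor, Ne.symm hab]
        rw [this]

variable [Fintype κ]

theorem sum_reduceOp (hA : IsCAR A) : ∑ s, star (reduceOp A s) * reduceOp A s = 1 := by
  have := hA.sum_star_mul_self (Finset.univ.sort (· ≥ ·)) (Finset.sort_nodup _ _)
  simpa [reduceOp] using this

/-- The coefficients are those in the definition of `annihilate`; the descending order in `reduceOp`
was chosen for this. -/
theorem reduceOp_mul (hA : IsCAR A) (s : Finset κ) (a : κ) :
    reduceOp A s * A a =
      if a ∈ s then 0 else (-1) ^ (s.filter (· < a)).card * reduceOp A (insert a s) := by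
  have hp : (Finset.univ.sort (· ≥ ·) : List κ).Pairwise (· > ·) := by
    have h1 : (Finset.univ.sort (· ≥ ·) : List κ).Pairwise (· ≥ ·) := Finset.pairwise_sort _ _
    have h2 : (Finset.univ.sort (· ≥ ·) : List κ).Pairwise (· ≠ ·) := Finset.sort_nodup _ _
    exact (h1.and h2).imp fun h => lt_of_le_of_ne h.1 h.2.symm
  have := hA.modeProd_mul_of_mem s a (Finset.univ.sort (· ≥ ·)) hp (by simp)
  rw [reduceOp, this]
  have hcard : (Finset.univ.sort (· ≥ ·) : List κ).countP (fun j => j ∈ s ∧ j < a)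
      = (s.filter (· < a)).card := by
    rw [List.countP_eq_length_filter,
      ← List.toFinset_card_of_nodup ((Finset.sort_nodup _ _).filter _)]
    congr 1
    ext j
    simp
  rw [hcard, reduceOp]

end IsCAR

end CAR

theorem sum_swap_pairs {ι M : Type*} [Fintype ι] [AddCommMonoid M] (f : ι → ι → ι → ι → M) :
    ∑ a, ∑ b, ∑ c, ∑ d, f a b c d = ∑ a, ∑ b, ∑ c, ∑ d, f c d a b := by
  have := Finset.sum_comm (s := Finset.univ) (t := Finset.univ)
    (f := fun p q : ι × ι => f p.1 p.2 q.1 q.2)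
  simpa only [Fintype.sum_prod_type] using this

/-! ### Anticommutation relations and particle-number sectors on Fock space -/

section FockOperators

variable {𝕜 ι : Type*} [RCLike 𝕜]

section

variable [LinearOrder ι]

/-- The sign `(-1)^{#{j ∈ s | j < i}}`. -/
def fermiSign (𝕜 : Type*) [RCLike 𝕜] {ι : Type*} [LinearOrder ι] (i : ι) (s : Finset ι) : 𝕜 :=
  (-1) ^ (s.filter (· < i)).card

theorem fermiSign_mul_self (i : ι) (s : Finset ι) : fermiSign 𝕜 i s * fermiSign 𝕜 i s = 1 := by
  rw [fermiSign, ← mul_pow]; simp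

theorem fermiSign_insert (j : ι) {i : ι} {s : Finset ι} (h : i ∉ s) :
    fermiSign 𝕜 j (insert i s) = (if i < j then -1 else 1) * fermiSign 𝕜 j s := by
  unfold fermiSign
  rw [Finset.filter_insert]
  split_ifs with hij
  · rw [Finset.card_insert_of_notMem (by simp [h]), pow_succ']
  · simp

theorem fermiSign_erase (j : ι) {i : ι} {s : Finset ι} (h : i ∈ s) :
    fermiSign 𝕜 j (s.erase i) = (if i < j then -1 else 1) * fermiSign 𝕜 j s := by
  conv_rhs => rw [← Finset.insert_erase h, fermiSign_insert j (Finset.notMem_erase i s)]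
  split_ifs <;> simp

theorem annihilate_apply (i : ι) (Ψ : Fock 𝕜 ι) (s : Finset ι) :
    annihilate i Ψ s = if i ∈ s then 0 else fermiSign 𝕜 i s * Ψ (insert i s) := rfl

theorem annihilate_anticomm (i j : ι) (Ψ : Fock 𝕜 ι) :
    annihilate i (annihilate j Ψ) + annihilate j (annihilate i Ψ) = 0 := by
  ext s
  simp only [PiLp.add_apply, annihilate_apply, PiLp.zero_apply]
  by_cases hi : i ∈ s
  · simp [hi]
  by_cases hj : j ∈ s
  · simp [hj]
  by_cases hij : i = j
  · simp [hij]
  simp only [hi, hj, if_false, Finset.mem_insert, hij, Ne.symm hij, or_self,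
    fermiSign_insert _ hi, fermiSign_insert _ hj, Finset.insert_comm i j]
  rcases lt_or_gt_of_ne hij with h | h
  · simp [h, h.not_gt]; ring
  · simp [h, h.not_gt]; ring

theorem annihilate_single (i : ι) (s : Finset ι) :
    annihilate i (EuclideanSpace.single s (1 : 𝕜)) =
      if i ∈ s then fermiSign 𝕜 i s • EuclideanSpace.single (s.erase i) 1 else 0 := by
  ext t
  rw [annihilate_apply]
  by_cases his : i ∈ s
  · by_cases hit : i ∈ t
    · have : t ≠ s.erase i := fun h => Finset.notMem_erase i s (h ▸ hit)
      simp [his, hit, this]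
    · by_cases h : t = s.erase i
      · subst h
        simp [his, fermiSign_erase i his, Finset.insert_erase his]
      · have : insert i t ≠ s := fun h' => h (by rw [← h', Finset.erase_insert hit])
        simp [his, hit, h, this]
  · have : insert i t ≠ s := fun h => his (h ▸ Finset.mem_insert_self i t)
    simp [his, this]

end

section

variable [Fintype ι]

/-- The subspace of wave functions with exactly `k` particles. -/
def sector (𝕜 ι : Type*) [RCLike 𝕜] [Fintype ι] (k : ℤ) : Submodule 𝕜 (Fock 𝕜 ι) where
  carrier := {Ψ | ∀ s : Finset ι, Ψ s ≠ 0 → (s.card : ℤ) = k}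
  zero_mem' := by intro s hs; simp at hs
  add_mem' {x y} hx hy s hs := by
    by_cases h : x s = 0
    · exact hy s (by simpa [h] using hs)
    · exact hx s h
  smul_mem' c x hx s hs := hx s (by simp at hs; exact hs.2)

theorem IsNParticleState.mem_sector {n : ℕ} {Ψ : Fock 𝕜 ι} (h : IsNParticleState n Ψ) :
    Ψ ∈ sector 𝕜 ι n := fun s hs => by rw [h.2 s hs]

theorem expect_real_smul (A : Fock 𝕜 ι →ₗ[𝕜] Fock 𝕜 ι) (r : ℝ) (Ψ : Fock 𝕜 ι) :
    expect A ((r : 𝕜) • Ψ) = ((r ^ 2 : ℝ) : 𝕜) * expect A Ψ := by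
  rw [expect, expect, map_smul, inner_smul_left, inner_smul_right, RCLike.conj_ofReal]
  push_cast
  ring

theorem exists_isNParticleState {k : ℤ} {Φ : Fock 𝕜 ι} (h : Φ ∈ sector 𝕜 ι k) :
    ∃ (n : ℕ) (Ψ : Fock 𝕜 ι), IsNParticleState n Ψ ∧ Φ = (‖Φ‖ : 𝕜) • Ψ := by
  classical
  by_cases h0 : Φ = 0
  -- A zero component carries zero weight, so any state will do; `k` may even be negative here, and
  -- the vacuum is used.
  · refine ⟨0, EuclideanSpace.single ∅ 1, ⟨by simp, fun s hs => ?_⟩, by simp [h0]⟩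
    by_contra hc
    have : s ≠ ∅ := fun h => hc (by simp [h])
    simp [this] at hs
  · have hn : (‖Φ‖ : 𝕜) ≠ 0 := by simpa using h0
    -- A nonzero coefficient makes `k` a cardinality, so `toNat` loses nothing.
    refine ⟨k.toNat, (‖Φ‖ : 𝕜)⁻¹ • Φ, ⟨?_, fun s hs => ?_⟩, ?_⟩
    · simp [norm_smul, h0]
    · have := h s (by simp at hs; exact hs.2)
      omega
    · rw [smul_smul, mul_inv_cancel₀ hn, one_smul]

end

variable [Fintype ι] [LinearOrder ι]

theorem create_apply (i : ι) (Ψ : Fock 𝕜 ι) (s : Finset ι) :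
    create i Ψ s = if i ∈ s then fermiSign 𝕜 i s * Ψ (s.erase i) else 0 := by
  have h : create i Ψ s = inner 𝕜 (EuclideanSpace.single s (1 : 𝕜)) (create i Ψ) := by
    simp [EuclideanSpace.inner_single_left]
  rw [h, create, LinearMap.adjoint_inner_right, annihilate_single]
  split_ifs
  · rw [inner_smul_left, EuclideanSpace.inner_single_left]
    simp [fermiSign]
  · simp

theorem annihilate_create_anticomm (i j : ι) (Ψ : Fock 𝕜 ι) :
    annihilate i (create j Ψ) + create j (annihilate i Ψ) = if i = j then Ψ else 0 := by
  ext s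
  simp only [PiLp.add_apply, annihilate_apply, create_apply]
  by_cases hij : i = j
  · subst hij
    by_cases hi : i ∈ s
    · simp [hi, fermiSign_erase i hi, ← mul_assoc, fermiSign_mul_self]
    · simp [hi, fermiSign_insert i hi, ← mul_assoc, fermiSign_mul_self]
  · by_cases hi : i ∈ s
    · simp [hi, hij]
    by_cases hj : j ∈ s
    · simp only [hi, hj, hij, if_true, if_false, Finset.mem_insert, Finset.mem_erase, or_true,
        and_false, fermiSign_insert j hi, fermiSign_erase i hj,
        Finset.erase_insert_of_ne hij, PiLp.zero_apply]
      rcases lt_or_gt_of_ne hij with h | h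
      · simp [h, h.not_gt]; ring
      · simp [h, h.not_gt]; ring
    · simp [hi, hj, hij, Ne.symm hij]

theorem create_annihilate_self (i : ι) (Ψ : Fock 𝕜 ι) (s : Finset ι) :
    create i (annihilate i Ψ) s = if i ∈ s then Ψ s else 0 := by
  rw [create_apply, annihilate_apply]
  split_ifs with h h'
  · exact absurd h' (Finset.notMem_erase i s)
  · rw [fermiSign_erase i h, Finset.insert_erase h]
    simp [← mul_assoc, fermiSign_mul_self]
  · rfl

theorem annihilate_mem_sector (i : ι) {k : ℤ} {Ψ : Fock 𝕜 ι} (h : Ψ ∈ sector 𝕜 ι k) :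
    annihilate i Ψ ∈ sector 𝕜 ι (k - 1) := by
  intro s hs
  rw [annihilate_apply] at hs
  split_ifs at hs with his
  · exact absurd rfl hs
  · have := h _ (right_ne_zero_of_mul hs)
    rw [Finset.card_insert_of_notMem his] at this
    push_cast at this
    omega

theorem create_mem_sector (i : ι) {k : ℤ} {Ψ : Fock 𝕜 ι} (h : Ψ ∈ sector 𝕜 ι k) :
    create i Ψ ∈ sector 𝕜 ι (k + 1) := by
  intro s hs
  rw [create_apply] at hs
  split_ifs at hs with his
  · have := h _ (right_ne_zero_of_mul hs)
    rw [Finset.card_erase_of_mem his] at this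
    have := Finset.card_pos.2 ⟨i, his⟩
    omega
  · exact absurd rfl hs

/-- The number operator acts on the `k`-particle sector as `k`. -/
theorem sum_inner_annihilate {k : ℤ} (Φ : Fock 𝕜 ι) {Ψ : Fock 𝕜 ι} (h : Ψ ∈ sector 𝕜 ι k) :
    ∑ i, inner 𝕜 (annihilate i Φ) (annihilate i Ψ) = (k : 𝕜) * inner 𝕜 Φ Ψ := by
  have key : ∑ i, create i (annihilate i Ψ) = (k : 𝕜) • Ψ := by
    ext s
    simp only [WithLp.ofLp_sum, Finset.sum_apply, create_annihilate_self, PiLp.smul_apply,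
      smul_eq_mul]
    rw [← Finset.sum_filter]
    by_cases hs : Ψ s = 0
    · simp [hs]
    · rw [← h s hs]; simp
  rw [← inner_smul_right, ← key, inner_sum]
  refine Finset.sum_congr rfl fun i _ => ?_
  rw [create, LinearMap.adjoint_inner_right]

theorem expect_oneBody (α β : ι) (Ψ : Fock 𝕜 ι) :
    expect (oneBody α β) Ψ = inner 𝕜 (annihilate α Ψ) (annihilate β Ψ) := by
  simp [expect, oneBody, create, LinearMap.adjoint_inner_right]

theorem expect_twoBody (α β γ δ : ι) (Ψ : Fock 𝕜 ι) :
    expect (twoBody α β γ δ) Ψ =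
      inner 𝕜 (annihilate β (annihilate α Ψ)) (annihilate δ (annihilate γ Ψ)) := by
  simp [expect, twoBody, create, LinearMap.adjoint_inner_right]

theorem expect_hamiltonian (t : ι → ι → 𝕜) (W : ι → ι → ι → ι → 𝕜) (Ψ : Fock 𝕜 ι) :
    expect (hamiltonian t W) Ψ = ∑ α, ∑ β, expect (oneBody α β) Ψ * t α β +
      (1 / 4 : 𝕜) * ∑ α, ∑ β, ∑ γ, ∑ δ, expect (twoBody α β γ δ) Ψ * W α β γ δ := by
  simp only [hamiltonian, expect, LinearMap.add_apply, LinearMap.smul_apply, LinearMap.sum_apply,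
    inner_add_right, inner_smul_right, inner_sum]
  simp only [mul_comm (t _ _), mul_comm (W _ _ _ _)]

/-- Conjugation swaps the bra and ket indices of each string, which the Hermitian symmetry of `t`
and `W` undoes. -/
theorem conj_expect_hamiltonian {t : ι → ι → 𝕜} {W : ι → ι → ι → ι → 𝕜}
    (ht : ∀ a b, t b a = star (t a b)) (hW : ∀ a b c d, W c d a b = star (W a b c d))
    (Ψ : Fock 𝕜 ι) :
    starRingEnd 𝕜 (expect (hamiltonian t W) Ψ) = expect (hamiltonian t W) Ψ := by
  simp only [expect_hamiltonian, expect_oneBody, expect_twoBody, map_add, map_mul, map_sum,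
    inner_conj_symm]
  congr 1
  · rw [Finset.sum_comm]
    refine Finset.sum_congr rfl fun a _ => Finset.sum_congr rfl fun b _ => ?_
    rw [ht a b, starRingEnd_apply, star_star]
  · congr 1
    · rw [map_div₀, map_one, map_ofNat]
    rw [sum_swap_pairs]
    refine Finset.sum_congr rfl fun a _ => Finset.sum_congr rfl fun b _ =>
      Finset.sum_congr rfl fun c _ => Finset.sum_congr rfl fun d _ => ?_
    rw [hW a b c d, starRingEnd_apply, star_star]

end FockOperators

theorem matrixElement_sum {𝕜 ι E : Type*} [RCLike 𝕜] [Fintype ι] [NormedAddCommGroup E]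
    [InnerProductSpace 𝕜 E] {m : ℕ} (e : OrthonormalBasis ι 𝕜 E)
    (w : Fin m → 𝕜) (Γ : Fin m → ι → ι → ι → ι → 𝕜) (f g h k : E) :
    matrixElement e (fun α β γ δ => ∑ i, w i * Γ i α β γ δ) f g h k =
      ∑ i, w i * matrixElement e (Γ i) f g h k := by
  simp only [matrixElement, Finset.mul_sum]
  -- Fixing one index type lets the ensemble sum cross the orbital sums in one direction only.
  simp only [Finset.sum_comm (γ := Fin m)]
  simp only [mul_left_comm]

/-! ### Annihilators of arbitrary orbitals -/

section Orbitals

variable {𝕜 ι E : Type*} [RCLike 𝕜] [Fintype ι] [LinearOrder ι]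
  [NormedAddCommGroup E] [InnerProductSpace 𝕜 E]

/-- The annihilation operator `a_f = ∑ ⟨f, e_γ⟩ a_γ` of an arbitrary orbital `f`. -/
def annihilateOrbital (e : OrthonormalBasis ι 𝕜 E) (f : E) : Fock 𝕜 ι →ₗ[𝕜] Fock 𝕜 ι :=
  ∑ γ, inner 𝕜 f (e γ) • annihilate γ

theorem annihilateOrbital_basis (e : OrthonormalBasis ι 𝕜 E) (β : ι) :
    annihilateOrbital e (e β) = annihilate β := by
  simp [annihilateOrbital, orthonormal_iff_ite.1 e.orthonormal]

theorem annihilateOrbital_mem_sector (e : OrthonormalBasis ι 𝕜 E) (f : E) {k : ℤ}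
    {Ψ : Fock 𝕜 ι} (h : Ψ ∈ sector 𝕜 ι k) : annihilateOrbital e f Ψ ∈ sector 𝕜 ι (k - 1) := by
  rw [annihilateOrbital, LinearMap.sum_apply]
  exact Submodule.sum_mem _ fun γ _ => Submodule.smul_mem _ _ (annihilate_mem_sector γ h)

theorem star_annihilateOrbital (e : OrthonormalBasis ι 𝕜 E) (f : E) :
    star (annihilateOrbital e f) = ∑ γ, inner 𝕜 (e γ) f • create (𝕜 := 𝕜) γ := by
  simp only [annihilateOrbital, star_sum, star_smul, LinearMap.star_eq_adjoint, create]
  simp only [← starRingEnd_apply, inner_conj_symm]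

theorem star_annihilateOrbital_mem_sector (e : OrthonormalBasis ι 𝕜 E) (f : E) {k : ℤ}
    {Ψ : Fock 𝕜 ι} (h : Ψ ∈ sector 𝕜 ι k) :
    star (annihilateOrbital e f) Ψ ∈ sector 𝕜 ι (k + 1) := by
  rw [star_annihilateOrbital, LinearMap.sum_apply]
  exact Submodule.sum_mem _ fun γ _ => Submodule.smul_mem _ _ (create_mem_sector γ h)

theorem annihilateOrbital_anticomm (e : OrthonormalBasis ι 𝕜 E) (f g : E) :
    annihilateOrbital e f * annihilateOrbital e g +
      annihilateOrbital e g * annihilateOrbital e f = 0 := by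
  have h (i j : ι) : (annihilate i : Fock 𝕜 ι →ₗ[𝕜] Fock 𝕜 ι) * annihilate j
      + annihilate j * annihilate i = 0 := LinearMap.ext (annihilate_anticomm i j)
  simp only [annihilateOrbital, Finset.sum_mul_sum]
  rw [Finset.sum_comm (f := fun i j => inner 𝕜 g (e i) • annihilate i * _), ← Finset.sum_add_distrib]
  refine Finset.sum_eq_zero fun i _ => ?_
  rw [← Finset.sum_add_distrib]
  refine Finset.sum_eq_zero fun j _ => ?_
  rw [smul_mul_smul_comm, smul_mul_smul_comm, mul_comm (inner 𝕜 g (e j)), ← smul_add, h, smul_zero]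

/-- The basis relations leave Σ_i ⟨f, e_i⟩⟨e_i, g⟩, which is ⟨f, g⟩ by Parseval. -/
theorem annihilateOrbital_mixed (e : OrthonormalBasis ι 𝕜 E) (f g : E) :
    annihilateOrbital e f * star (annihilateOrbital e g) +
      star (annihilateOrbital e g) * annihilateOrbital e f = inner 𝕜 f g • 1 := by
  have h (i j : ι) : (annihilate i : Fock 𝕜 ι →ₗ[𝕜] Fock 𝕜 ι) * create j
      + create j * annihilate i = if i = j then 1 else 0 := by
    refine LinearMap.ext fun Ψ => ?_
    have := annihilate_create_anticomm i j Ψ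
    split_ifs at this ⊢ <;> exact this
  rw [star_annihilateOrbital]
  simp only [annihilateOrbital, Finset.sum_mul_sum]
  rw [Finset.sum_comm (f := fun i j => inner 𝕜 (e i) g • create i * _), ← Finset.sum_add_distrib,
    ← e.sum_inner_mul_inner f g, Finset.sum_smul]
  refine Finset.sum_congr rfl fun i _ => ?_
  rw [← Finset.sum_add_distrib]
  simp only [smul_mul_smul_comm, mul_comm (inner 𝕜 (e _) g), ← smul_add, h]
  simp

theorem isCAR_annihilateOrbital {κ : Type*} [DecidableEq κ] (e : OrthonormalBasis ι 𝕜 E)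
    {v : κ → E} (hv : Orthonormal 𝕜 v) : IsCAR fun a => annihilateOrbital e (v a) where
  anticomm a b := annihilateOrbital_anticomm e _ _
  sq a := by
    have h := annihilateOrbital_anticomm e (v a) (v a)
    rw [← two_smul 𝕜] at h
    exact (smul_eq_zero.1 h).resolve_left two_ne_zero
  mixed a b := by
    rw [annihilateOrbital_mixed, orthonormal_iff_ite.1 hv]
    split_ifs <;> simp

/-- `annihilateOrbital` is antilinear in its orbital; in the bra this becomes linearity in `f, g`,
in the ket antilinearity in `h, k`. -/
theorem matrixElement_expect (e : OrthonormalBasis ι 𝕜 E) (Ψ : Fock 𝕜 ι) (f g h k : E) :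
    matrixElement e (fun α β γ δ => expect (twoBody α β γ δ) Ψ) f g h k =
      inner 𝕜 (annihilateOrbital e g (annihilateOrbital e f Ψ))
        (annihilateOrbital e k (annihilateOrbital e h Ψ)) := by
  simp only [matrixElement, expect_twoBody, annihilateOrbital, LinearMap.sum_apply,
    LinearMap.smul_apply, map_sum, map_smul, sum_inner, inner_sum, inner_smul_left,
    inner_smul_right, inner_conj_symm, Finset.mul_sum]
  rw [sum_swap_pairs]
  refine Finset.sum_congr rfl fun a _ => Finset.sum_congr rfl fun b _ =>
    Finset.sum_congr rfl fun c _ => Finset.sum_congr rfl fun d _ => ?_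
  ring

end Orbitals

/-! ### Reduction of states to the subsystem -/

section Reduction

theorem modeProd_mem_sector {𝕜 ι κ : Type*} [RCLike 𝕜] [Fintype ι] [DecidableEq κ]
    {A : κ → Fock 𝕜 ι →ₗ[𝕜] Fock 𝕜 ι}
    (hA : ∀ a k, ∀ Ψ ∈ sector 𝕜 ι k, A a Ψ ∈ sector 𝕜 ι (k - 1))
    (hA' : ∀ a k, ∀ Ψ ∈ sector 𝕜 ι k, star (A a) Ψ ∈ sector 𝕜 ι (k + 1))
    (s : Finset κ) (l : List κ) {k : ℤ} {Ψ : Fock 𝕜 ι} (h : Ψ ∈ sector 𝕜 ι k) :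
    modeProd A s l Ψ ∈ sector 𝕜 ι (k - l.countP (· ∈ s)) := by
  induction l with
  | nil => simpa [modeProd] using h
  | cons a l ih =>
    rw [modeProd_cons, Module.End.mul_apply, modeFactor]
    split_ifs with ha
    · rw [List.countP_cons_of_pos (by simpa using ha)]
      convert hA a _ _ ih using 2
      push_cast; ring
    · rw [List.countP_cons_of_neg (by simpa using ha), Module.End.mul_apply]
      convert hA a _ _ (hA' a _ _ ih) using 2
      ring

variable {𝕜 ι κ : Type*} [RCLike 𝕜] [Fintype ι] [Fintype κ] [LinearOrder κ]

/-- The component of `Ψ` in `Fock(κ) ⊗ |u⟩`, where the modes `κ` are embedded into the Fock space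
over `ι` by the annihilation operators `A`. -/
def reduceState (A : κ → Fock 𝕜 ι →ₗ[𝕜] Fock 𝕜 ι) (u : Finset ι) (Ψ : Fock 𝕜 ι) : Fock 𝕜 κ :=
  WithLp.toLp 2 fun s => reduceOp A s Ψ u

theorem annihilate_reduceState {A : κ → Fock 𝕜 ι →ₗ[𝕜] Fock 𝕜 ι} (hA : IsCAR A)
    (u : Finset ι) (a : κ) (Ψ : Fock 𝕜 ι) :
    annihilate a (reduceState A u Ψ) = reduceState A u (A a Ψ) := by
  ext s
  rw [annihilate_apply]
  have h : reduceOp A s (A a Ψ) = (reduceOp A s * A a) Ψ := rfl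
  have hn (n : ℕ) (Φ : Fock 𝕜 ι) :
      ((-1 : Fock 𝕜 ι →ₗ[𝕜] Fock 𝕜 ι) ^ n) Φ = (-1 : 𝕜) ^ n • Φ := by
    rcases neg_one_pow_eq_or (Fock 𝕜 ι →ₗ[𝕜] Fock 𝕜 ι) n with h | h <;>
    rcases Nat.even_or_odd n with h' | h' <;> simp [h'.neg_one_pow]
  simp only [reduceState]
  rw [h, hA.reduceOp_mul]
  split_ifs
  · simp
  · rw [Module.End.mul_apply, hn]
    simp [fermiSign]

/-- Summing over `u` and `s` gives Σ_s ⟨P_s Φ, P_s Ψ⟩, and Σ_s P_s† P_s = 1. -/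
theorem sum_inner_reduceState {A : κ → Fock 𝕜 ι →ₗ[𝕜] Fock 𝕜 ι} (hA : IsCAR A)
    (Φ Ψ : Fock 𝕜 ι) :
    ∑ u, inner 𝕜 (reduceState A u Φ) (reduceState A u Ψ) = inner 𝕜 Φ Ψ := by
  have h : inner 𝕜 Φ Ψ = ∑ s, inner 𝕜 (reduceOp A s Φ) (reduceOp A s Ψ) := by
    conv_lhs => rw [← Module.End.one_apply (R := 𝕜) Ψ, ← hA.sum_reduceOp, LinearMap.sum_apply,
      inner_sum]
    refine Finset.sum_congr rfl fun s _ => ?_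
    rw [Module.End.mul_apply, LinearMap.star_eq_adjoint, LinearMap.adjoint_inner_right]
  rw [h]
  simp only [PiLp.inner_apply, reduceState]
  exact Finset.sum_comm

/-- `reduceOp A s` removes |s| particles and `u` contains those that remain, so |s| + |u| = k. -/
theorem reduceState_mem_sector {A : κ → Fock 𝕜 ι →ₗ[𝕜] Fock 𝕜 ι}
    (hA : ∀ a k, ∀ Ψ ∈ sector 𝕜 ι k, A a Ψ ∈ sector 𝕜 ι (k - 1))
    (hA' : ∀ a k, ∀ Ψ ∈ sector 𝕜 ι k, star (A a) Ψ ∈ sector 𝕜 ι (k + 1))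
    (u : Finset ι) {k : ℤ} {Ψ : Fock 𝕜 ι} (h : Ψ ∈ sector 𝕜 ι k) :
    reduceState A u Ψ ∈ sector 𝕜 κ (k - u.card) := by
  intro s hs
  have := modeProd_mem_sector hA hA' s (Finset.univ.sort (· ≥ ·)) h u hs
  have hcard : (Finset.univ.sort (· ≥ ·) : List κ).countP (· ∈ s) = s.card := by
    rw [List.countP_eq_length_filter,
      ← List.toFinset_card_of_nodup ((Finset.sort_nodup _ _).filter _)]
    congr 1
    ext j
    simp
  rw [hcard] at this
  omega

theorem exists_fracEnsemble {A : κ → Fock 𝕜 ι →ₗ[𝕜] Fock 𝕜 ι} (hCAR : IsCAR A)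
    (hA : ∀ a k, ∀ Ψ ∈ sector 𝕜 ι k, A a Ψ ∈ sector 𝕜 ι (k - 1))
    (hA' : ∀ a k, ∀ Ψ ∈ sector 𝕜 ι k, star (A a) Ψ ∈ sector 𝕜 ι (k + 1))
    {N m : ℕ} {w : Fin m → ℝ} {Ψ : Fin m → Fock 𝕜 ι} (hw : ∀ i, 0 ≤ w i) (hw1 : ∑ i, w i = 1)
    (hΨ : ∀ i, IsNParticleState N (Ψ i)) :
    ∃ (M : ℕ) (x : Fin M → ℝ) (n : Fin M → ℕ) (Φ : Fin M → Fock 𝕜 κ),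
      IsFracEnsemble (∑ i, x i * (n i : ℝ)) x n Φ ∧
      ∀ B : Fock 𝕜 κ →ₗ[𝕜] Fock 𝕜 κ, ∑ k, (x k : 𝕜) * expect B (Φ k) =
        ∑ i, (w i : 𝕜) * ∑ u, expect B (reduceState A u (Ψ i)) := by
  have hex (p : Fin m × Finset ι) :=
    exists_isNParticleState (reduceState_mem_sector hA hA' p.2 (hΨ p.1).mem_sector)
  choose n Φ hΦ hred using hex
  let r (p : Fin m × Finset ι) : ℝ := ‖reduceState A p.2 (Ψ p.1)‖
  let eq := (Fintype.equivFin (Fin m × Finset ι)).symm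
  have hnorm (i : Fin m) : ∑ u, r (i, u) ^ 2 = 1 := by
    have h := sum_inner_reduceState hCAR (Ψ i) (Ψ i)
    simp only [inner_self_eq_norm_sq_to_K, (hΨ i).1, RCLike.ofReal_one, one_pow] at h
    exact_mod_cast h
  -- One member for each pair (i, u), weighted by `w i` times the squared norm of the component; the
  -- weights sum to 1 because these squared norms sum to 1 for each i.
  refine ⟨_, fun k => w (eq k).1 * r (eq k) ^ 2, fun k => n (eq k), fun k => Φ (eq k),
    ⟨fun k => mul_nonneg (hw _) (sq_nonneg _), ?_, rfl, fun k => hΦ _⟩, fun B => ?_⟩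
  · rw [eq.sum_comp (fun p => w p.1 * r p ^ 2), Fintype.sum_prod_type, ← hw1]
    refine Finset.sum_congr rfl fun i _ => ?_
    simp only [← Finset.mul_sum, hnorm, mul_one]
  · rw [eq.sum_comp (fun p => ((w p.1 * r p ^ 2 : ℝ) : 𝕜) * expect B (Φ p)),
      Fintype.sum_prod_type]
    refine Finset.sum_congr rfl fun i _ => ?_
    rw [Finset.mul_sum]
    refine Finset.sum_congr rfl fun u _ => ?_
    rw [hred (i, u), expect_real_smul, RCLike.ofReal_mul, mul_assoc]

end Reduction

/-! ### Energy and trace of an ensemble -/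

section Energy

theorem groundEnergy_le {𝕜 κ : Type*} [RCLike 𝕜] [Fintype κ] {Nbar : ℝ}
    (H : Fock 𝕜 κ →ₗ[𝕜] Fock 𝕜 κ) {m : ℕ} {x : Fin m → ℝ}
    {n : Fin m → ℕ} {Φ : Fin m → Fock 𝕜 κ} (h : IsFracEnsemble Nbar x n Φ) :
    groundEnergy Nbar H ≤ ∑ i, x i * RCLike.re (expect H (Φ i)) := by
  -- The infimum in ℝ is meaningful only for a set bounded below; minus the operator norm of `H` is
  -- a bound.
  refine csInf_le ⟨-‖LinearMap.toContinuousLinearMap H‖, ?_⟩ ⟨m, x, n, Φ, h, rfl⟩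
  rintro _ ⟨m, x, n, Φ, ⟨hx, hx1, -, hΦ⟩, rfl⟩
  have hle (i : Fin m) : -‖LinearMap.toContinuousLinearMap H‖ ≤ RCLike.re (expect H (Φ i)) := by
    have h1 : ‖expect H (Φ i)‖ ≤ ‖LinearMap.toContinuousLinearMap H‖ := by
      refine (norm_inner_le_norm _ _).trans ?_
      rw [(hΦ i).1, one_mul]
      simpa [(hΦ i).1] using (LinearMap.toContinuousLinearMap H).le_opNorm (Φ i)
    have := (abs_le.1 ((RCLike.abs_re_le_norm _).trans h1)).1
    exact this
  calc _ = ∑ i, x i * -‖LinearMap.toContinuousLinearMap H‖ := by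
        rw [← Finset.sum_mul, hx1, one_mul]
    _ ≤ _ := Finset.sum_le_sum fun i _ => mul_le_mul_of_nonneg_left (hle i) (hx i)

variable {𝕜 κ : Type*} [RCLike 𝕜] [Fintype κ] [LinearOrder κ]

theorem energy_of_ensemble {m : ℕ} (x : Fin m → 𝕜) (Φ : Fin m → Fock 𝕜 κ)
    (t : κ → κ → 𝕜) (W : κ → κ → κ → κ → 𝕜) :
    energy (fun a b => ∑ i, x i * expect (oneBody a b) (Φ i))
      (fun a b c d => ∑ i, x i * expect (twoBody a b c d) (Φ i)) t W =
    ∑ i, x i * expect (hamiltonian t W) (Φ i) := by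
  simp only [energy, expect_hamiltonian, mul_add, Finset.sum_add_distrib, Finset.mul_sum,
    Finset.sum_mul]
  simp only [Finset.sum_comm (γ := Fin m)]
  simp only [mul_assoc, mul_left_comm (1 / 4 : 𝕜)]

theorem trace₁_of_ensemble {Nbar : ℝ} {m : ℕ} {x : Fin m → ℝ} {n : Fin m → ℕ}
    {Φ : Fin m → Fock 𝕜 κ} (h : IsFracEnsemble Nbar x n Φ) :
    trace₁ (fun a b => ∑ i, (x i : 𝕜) * expect (oneBody a b) (Φ i)) = Nbar := by
  rw [trace₁, Finset.sum_comm, ← h.2.2.1]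
  push_cast
  refine Finset.sum_congr rfl fun i _ => ?_
  rw [← Finset.mul_sum]
  congr 1
  simp only [expect_oneBody]
  rw [sum_inner_annihilate _ (h.2.2.2 i).mem_sector, inner_self_eq_norm_sq_to_K, (h.2.2.2 i).1]
  simp

end Energy

theorem isFracRepresentable_subsystem {𝕜 E ι κ : Type*} [RCLike 𝕜] [NormedAddCommGroup E]
    [InnerProductSpace 𝕜 E] [Fintype ι] [LinearOrder ι] (e : OrthonormalBasis ι 𝕜 E) {N : ℕ}
    (hN : 2 ≤ N) {Γ : ι → ι → ι → ι → 𝕜} (hΓ : IsNRepresentable N Γ) (V : Submodule 𝕜 E)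
    [Fintype κ] [LinearOrder κ] (v : OrthonormalBasis κ 𝕜 V) :
    ∃ Nbar : ℝ, IsFracRepresentable Nbar (subsystem1DM N e V v Γ) (subsystem2DM e V v Γ) := by
  obtain ⟨m, w, Ψ, hw, hw1, hΨ, hΓ⟩ := hΓ
  obtain rfl : Γ = fun α β γ δ => ∑ i, (w i : 𝕜) * expect (twoBody α β γ δ) (Ψ i) := by
    funext α β γ δ
    exact hΓ α β γ δ
  have hv : Orthonormal 𝕜 fun a => (v a : E) :=
    v.orthonormal.comp_linearIsometry V.subtypeₗᵢ
  have hCAR := isCAR_annihilateOrbital e hv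
  obtain ⟨M, x, n, Φ, hens, hB⟩ := exists_fracEnsemble hCAR
    (fun a k Ψ h => annihilateOrbital_mem_sector e _ h)
    (fun a k Ψ h => star_annihilateOrbital_mem_sector e _ h) hw hw1 hΨ
  refine ⟨_, M, x, n, Φ, hens, fun a c => ?_, fun a b c d => ?_⟩
  · rw [hB, subsystem1DM]
    simp only [matrixElement_sum, matrixElement_expect]
    rw [Finset.sum_comm, Finset.mul_sum]
    refine Finset.sum_congr rfl fun i _ => ?_
    simp only [expect_oneBody, annihilate_reduceState hCAR, annihilateOrbital_basis]
    -- On the one-body side the sum over `u` returns ⟨A_a Ψ, A_c Ψ⟩; on the other side the sum over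
    -- β is the number operator on the (N-1)-particle vector A_c Ψ, producing the factor N - 1.
    rw [sum_inner_reduceState hCAR, ← Finset.mul_sum, sum_inner_annihilate _
      (annihilateOrbital_mem_sector e _ (hΨ i).mem_sector)]
    have hN0 : (N : 𝕜) - 1 ≠ 0 := by
      rw [sub_ne_zero]
      exact_mod_cast (by omega : N ≠ 1)
    push_cast
    field_simp
  · rw [hB, subsystem2DM]
    simp only [matrixElement_sum, matrixElement_expect]
    refine Finset.sum_congr rfl fun i _ => ?_
    simp only [expect_twoBody, annihilate_reduceState hCAR]
    rw [sum_inner_reduceState hCAR]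

end

end SubsystemConstraints

open SubsystemConstraints in
theorem mainTheorem2 {𝕜 : Type*} [RCLike 𝕜] {E : Type*} [NormedAddCommGroup E]
    [InnerProductSpace 𝕜 E] {ι : Type*} [Fintype ι] [LinearOrder ι]
    (e : OrthonormalBasis ι 𝕜 E) (N : ℕ) (hN : 2 ≤ N) (Γ : ι → ι → ι → ι → 𝕜)
    (hΓ : IsNRepresentable N Γ) (V : Submodule 𝕜 E) {κ : Type*} [Fintype κ] [LinearOrder κ]
    (v : OrthonormalBasis κ 𝕜 V) :
    ∃ Nbar : ℝ, (Nbar : 𝕜) = trace₁ (subsystem1DM N e V v Γ) ∧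
      IsFracRepresentable Nbar (subsystem1DM N e V v Γ) (subsystem2DM e V v Γ) ∧
      ∀ (t : κ → κ → 𝕜) (W : κ → κ → κ → κ → 𝕜),
        (∀ a b, t b a = star (t a b)) → (∀ a b c d, W c d a b = star (W a b c d)) →
        ∃ En : ℝ, (En : 𝕜) = energy (subsystem1DM N e V v Γ) (subsystem2DM e V v Γ) t W ∧
          groundEnergy Nbar (hamiltonian t W) ≤ En := by
  obtain ⟨Nbar, M, x, n, Φ, hens, hρ, hΓ'⟩ := isFracRepresentable_subsystem e hN hΓ V v
  have hρ' : subsystem1DM N e V v Γ = fun a b => ∑ i, (x i : 𝕜) * expect (oneBody a b) (Φ i) := by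
    funext a b
    exact hρ a b
  have hΓ'' : subsystem2DM e V v Γ =
      fun a b c d => ∑ i, (x i : 𝕜) * expect (twoBody a b c d) (Φ i) := by
    funext a b c d
    exact hΓ' a b c d
  refine ⟨Nbar, ?_, ⟨M, x, n, Φ, hens, hρ, hΓ'⟩, fun t W ht hW =>
    ⟨∑ i, x i * RCLike.re (expect (hamiltonian t W) (Φ i)), ?_, groundEnergy_le _ hens⟩⟩
  · rw [hρ', trace₁_of_ensemble hens]
  · rw [hρ', hΓ'', energy_of_ensemble]
    push_cast
    refine Finset.sum_congr rfl fun i _ => ?_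
    -- Each expectation value equals its real part, so the real mean energy is the `𝕜`-valued one.
    exact congrArg _ (RCLike.conj_eq_iff_re.1 (conj_expect_hamiltonian ht hW (Φ i)))
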